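/- Let $V$ be a real vector space of finite even dimension $n$ and let $\omega\colon V\times V\to\mathbb R$ be a non-degenerate skew-symmetric bilinear form. For a finite-dimensional real vector space $W$ write $\Gamma(W)=C^\infty(V,W)$ for the $C^\infty(V)$-module of smooth sections of the trivial bundle $W\times V\to V$; thus $\Gamma(V)=\mathfrak X(V)$. Let $\mathfrak{sp}(V,\omega)=\{A\in\mathfrak{gl}(V)\mid \omega(Ax,y)+\omega(x,Ay)=0\ \ \forall x,y\in V\}$, let $\rho\colon\Gamma(\mathfrak{sp}(V,\omega))\to\mathfrak X(V)$ be the anchor $\rho(A)(x)=A(x)\,x$, and let $\mathcal F_\omega(V)=\rho(\Gamma(\mathfrak{sp}(V,\omega)))$ be the induced singular foliation. For $A\in\mathfrak{gl}(V)$ put $(A\cdot\omega)(x,y)=\omega(Ax,y)+\omega(x,Ay)$. Identify $\wedge^pV^*\otimes W$ with $\mathrm{Hom}(\wedge^pV,W)$ and, for $p\ge1$, let $$\phi^\omega_p\colon\wedge^pV^*\otimes V\to\wedge^{p-1}V^*\otimes\wedge^2V^*,\qquad \phi^\omega_p(\psi)(v_1,\dots,v_{p-1})=\psi(v_1,\dots,v_{p-1},-)\cdot\omega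 ,$$ that is, $\phi^\omega_p(\alpha\otimes X)=(-1)^{p-1}\sum_i\iota_{e_i}\alpha\otimes (e^i\wedge\iota_X\omega)$ for dual bases $(e_i)$, $(e^i)$ of $V$, $V^*$. Let $d_p\colon\Gamma(\wedge^pV^*\otimes V)\to\Gamma(\wedge^{p-1}V^*\otimes V)$ be the contraction with the Euler vector field, $(d_p\psi)(x)=\iota_x(\psi(x))$, and let $\partial_p\colon\Gamma(\wedge^pV^*\otimes\wedge^2V^*)\to\Gamma(\wedge^{p-1}V^*\otimes\wedge^2V^*)$ be minus the contraction with the Euler vector field. Then $\phi^\omega_pd_{p+1}+\partial_p\phi^\omega_{p+1}=0$ and $\phi^\omega_2$ is an isomorphism. Put $C_i=\mathrm{coker}(\phi^\omega_i)$ for $i\ge3$; since $\wedge^{n+1}V^*=0$, one has $C_{n+1}=\wedge^nV^*\otimes\wedge^2V^*$ and $C_i=0$ for $i\ge n+2$. Let $\bar\partial_i\colon\Gamma(C_{i+1})\to\Gamma(C_i)$ be the map induced by $\partial_i$. The map $d_2(\phi^\omega_2)^{-1}\partial_2$ vanishes on the image of $\phi^\omega_3$ and takes values in $\Gamma(\mathfrak{sp}(V,\omega))$,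 so it induces a map $\Gamma(C_3)\to\Gamma(\mathfrak{sp}(V,\omega))$. Then the sequence of $C^\infty(V)$-modules $$0\to\Gamma(C_{n+1})\xrightarrow{\bar\partial_n}\Gamma(C_n)\xrightarrow{\bar\partial_{n-1}}\cdots\xrightarrow{\bar\partial_3}\Gamma(C_3)\xrightarrow{d_2(\phi^\omega_2)^{-1}\partial_2}\Gamma(\mathfrak{sp}(V,\omega))\xrightarrow{\ \rho\ }\mathcal F_\omega(V)\to0$$ is exact, and the modules $\Gamma(C_i)$, $i\ge3$, and $\Gamma(\mathfrak{sp}(V,\omega))$ are projective; that is, the sequence is a projective resolution of $\mathcal F_\omega(V)$ over $C^\infty(V)$. -/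

import Mathlib

open scoped Manifold

namespace LinearSymplectic

section Sections

open scoped ContDiff

/-- The ring `C^∞(V)` of smooth real functions on `V`. -/
abbrev Fun (V : Type*) [NormedAddCommGroup V] [NormedSpace ℝ V] : Type _ :=
  C^∞⟮𝓘(ℝ, V), V; 𝓘(ℝ, ℝ), ℝ⟯

/-- `Γ(A)`: the `C^∞(V)`-module of smooth sections of the trivial bundle `A × V → V`, that is of
smooth maps `V → A`. In particular `Sec V V` is the module of vector fields on `V`. -/
abbrev Sec (V : Type*) [NormedAddCommGroup V] [NormedSpace ℝ V]
    (A : Type*) [NormedAddCommGroup A] [NormedSpace ℝ A] : Type _ :=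
  C^∞⟮𝓘(ℝ, V), V; 𝓘(ℝ, A), A⟯

/-- A family `D x : A → B` of linear maps, smooth in `x : V`, acts on sections by
`(D f)(x) = D x (f x)`, and this is `C^∞(V)`-linear. -/
noncomputable def secMap {V : Type*} [NormedAddCommGroup V] [NormedSpace ℝ V]
    {A : Type*} [NormedAddCommGroup A] [NormedSpace ℝ A]
    {B : Type*} [NormedAddCommGroup B] [NormedSpace ℝ B]
    (D : V → A →ₗ[ℝ] B) (hD : ∀ f : V → A, ContDiff ℝ ∞ f → ContDiff ℝ ∞ (fun x => D x (f x))) :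
    Sec V A →ₗ[Fun V] Sec V B where
  toFun f := ⟨fun x => D x (f x), (hD f f.contMDiff.contDiff).contMDiff⟩
  map_add' f g := by
    ext x
    exact map_add (D x) (f x) (g x)
  map_smul' c f := by
    ext x
    exact map_smul (D x) (c x) (f x)

end Sections

theorem linear_smooth {V : Type*} [NormedAddCommGroup V] [NormedSpace ℝ V]
    (A : Type*) [NormedAddCommGroup A] [NormedSpace ℝ A] [FiniteDimensional ℝ A]
    (B : Type*) [NormedAddCommGroup B] [NormedSpace ℝ B]
    (L : A →ₗ[ℝ] B) {f : V → A} (hf : ContDiff ℝ (⊤ : ℕ∞) f) :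
    ContDiff ℝ (⊤ : ℕ∞) (fun x => L (f x)) :=
  (LinearMap.toContinuousLinearMap L).contDiff.comp hf

section Fibres

variable {V : Type*} [NormedAddCommGroup V] [NormedSpace ℝ V]
variable {A : Type*} [NormedAddCommGroup A] [NormedSpace ℝ A]

instance finiteDimensional_forms [FiniteDimensional ℝ V] [FiniteDimensional ℝ A] (p : ℕ) :
    FiniteDimensional ℝ (V [⋀^Fin p]→L[ℝ] A) :=
  FiniteDimensional.of_injective
    ((AlternatingMap.toMultilinearMapLM (S := ℝ)).comp
      (ContinuousAlternatingMap.toAlternatingMapLinear (R := ℝ) (A := ℝ) (M := V) (N := A)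
        (ι := Fin p)))
    (fun a b h => by
      ext v
      exact congrArg (fun g : MultilinearMap ℝ (fun _ : Fin p => V) A => g v) h)

/-- Contraction with the vector `x` in the first slot:
`(ι_x ψ)(v₁, …, v_p) = ψ(x, v₁, …, v_p)`. Throughout, `V [⋀^Fin p]→L[ℝ] A` is the space
`Hom(⋀^p V, A) = ⋀^p V* ⊗ A` of `A`-valued alternating `p`-forms on `V`. In linear coordinates
`x = x^i e_i`, so that `ι_x (α ⊗ a) = x^i ι_{e_i} α ⊗ a`: applied at each point `x` of `V`, this is
the contraction with the Euler vector field. -/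
noncomputable def contract (p : ℕ) (x : V) :
    (V [⋀^Fin (p + 1)]→L[ℝ] A) →ₗ[ℝ] (V [⋀^Fin p]→L[ℝ] A) where
  toFun ψ := ψ.curryLeft x
  map_add' _ _ := rfl
  map_smul' _ _ := rfl

theorem contract_apply (p : ℕ) (x : V) (ψ : V [⋀^Fin (p + 1)]→L[ℝ] A) (v : Fin p → V) :
    contract p x ψ v = ψ (Matrix.vecCons x v) := rfl

theorem contract_contract (p : ℕ) (x : V) (ψ : V [⋀^Fin (p + 1 + 1)]→L[ℝ] A) :
    contract p x (contract (p + 1) x ψ) = 0 := by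
  ext v
  exact ψ.map_eq_zero_of_eq _ (i := 0) (j := 1) (by simp) (by simp)

theorem contract_smooth (p : ℕ) {f : V → V [⋀^Fin (p + 1)]→L[ℝ] A}
    (hf : ContDiff ℝ (⊤ : ℕ∞) f) : ContDiff ℝ (⊤ : ℕ∞) (fun x => contract p x (f x)) := by
  let L : (V [⋀^Fin (p + 1)]→L[ℝ] A) →L[ℝ] (V →L[ℝ] V [⋀^Fin p]→L[ℝ] A) :=
    ContinuousAlternatingMap.curryLeftLI.toContinuousLinearMap
  exact (L.contDiff.comp hf).clm_apply contDiff_id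

/-- The identification of `⋀^1 V* ⊗ V` with `gl(V)`. -/
noncomputable def toEnd : (V [⋀^Fin 1]→L[ℝ] V) ≃ₗᵢ[ℝ] (V →L[ℝ] V) :=
  (ContinuousAlternatingMap.ofSubsingletonLIE (𝕜 := ℝ) (E := V) (F := V) (0 : Fin 1)).symm

theorem toEnd_apply (ψ : V [⋀^Fin 1]→L[ℝ] V) (v : V) : toEnd ψ v = ψ ![v] := by
  obtain ⟨B, rfl⟩ := (toEnd (V := V)).symm.surjective ψ
  rw [LinearIsometryEquiv.apply_symm_apply]
  rfl

/-- The space `⋀² V*` of skew-symmetric bilinear forms on `V`. It is given a name of its own only to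
have a single normed space structure when it serves as the codomain of forms. -/
def TwoForm (V : Type*) [NormedAddCommGroup V] [NormedSpace ℝ V] : Type _ := V [⋀^Fin 2]→L[ℝ] ℝ

noncomputable instance : NormedAddCommGroup (TwoForm V) :=
  inferInstanceAs (NormedAddCommGroup (V [⋀^Fin 2]→L[ℝ] ℝ))

noncomputable instance : NormedSpace ℝ (TwoForm V) :=
  inferInstanceAs (NormedSpace ℝ (V [⋀^Fin 2]→L[ℝ] ℝ))

instance : FunLike (TwoForm V) (Fin 2 → V) ℝ :=
  inferInstanceAs (FunLike (V [⋀^Fin 2]→L[ℝ] ℝ) (Fin 2 → V) ℝ)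

instance [FiniteDimensional ℝ V] : FiniteDimensional ℝ (TwoForm V) :=
  finiteDimensional_forms 2

@[ext] theorem TwoForm.ext {α β : TwoForm V} (h : ∀ v, α v = β v) : α = β := DFunLike.ext _ _ h

theorem TwoForm.add_apply (α β : TwoForm V) (v : Fin 2 → V) : (α + β) v = α v + β v := rfl

theorem TwoForm.smul_apply (r : ℝ) (α : TwoForm V) (v : Fin 2 → V) : (r • α) v = r * α v := rfl

theorem TwoForm.zero_apply (v : Fin 2 → V) : (0 : TwoForm V) v = 0 := rfl

/-- The value at the point `x` of the differential
`∂_{p+1} : Γ(⋀^{p+1} V* ⊗ ⋀² V*) → Γ(⋀^p V* ⊗ ⋀² V*)`, minus the contraction with the Euler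
vector field: `∂_{p+1}(α ⊗ τ) = -x^i ι_{e_i} α ⊗ τ`. -/
noncomputable def del (p : ℕ) (x : V) : (V [⋀^Fin (p + 1)]→L[ℝ] TwoForm V) →ₗ[ℝ]
    (V [⋀^Fin p]→L[ℝ] TwoForm V) :=
  - contract p x

theorem del_del (p : ℕ) (x : V) (τ : V [⋀^Fin (p + 1 + 1)]→L[ℝ] TwoForm V) :
    del p x (del (p + 1) x τ) = 0 := by
  simp only [del, LinearMap.neg_apply, map_neg, contract_contract, neg_zero]

theorem del_smooth (p : ℕ) {f : V → V [⋀^Fin (p + 1)]→L[ℝ] TwoForm V}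
    (hf : ContDiff ℝ (⊤ : ℕ∞) f) : ContDiff ℝ (⊤ : ℕ∞) (fun x => del p x (f x)) :=
  (contract_smooth p hf).neg

end Fibres

section Symplectic

variable {V : Type*} [NormedAddCommGroup V] [NormedSpace ℝ V]
variable (ω : V [⋀^Fin 2]→L[ℝ] ℝ)

/-- Non-degeneracy of a skew-symmetric bilinear form. -/
def Nondegenerate : Prop := ∀ x : V, (∀ y : V, ω ![x, y] = 0) → x = 0

theorem form_add_left (a b c : V) : ω ![a + b, c] = ω ![a, c] + ω ![b, c] := by
  have e : ∀ d, Function.update ![a, c] 0 d = ![d, c] := by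
    intro d
    ext i
    fin_cases i <;> rfl
  have h := ω.map_update_add ![a, c] 0 a b
  rwa [e, e, e] at h

theorem form_smul_left (r : ℝ) (a c : V) : ω ![r • a, c] = r * ω ![a, c] := by
  have e : ∀ d, Function.update ![a, c] 0 d = ![d, c] := by
    intro d
    ext i
    fin_cases i <;> rfl
  have h := ω.map_update_smul ![a, c] 0 r a
  rwa [e, e] at h

theorem form_swap (a b : V) : ω ![a, b] = - ω ![b, a] := by
  have h := ω.toAlternatingMap.map_swap ![b, a] (i := 0) (j := 1) (by simp)
  refine Eq.trans (congrArg ω ?_) h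
  ext i
  fin_cases i <;> simp

theorem form_add_right (a b c : V) : ω ![a, b + c] = ω ![a, b] + ω ![a, c] := by
  rw [form_swap, form_add_left, form_swap ω a b, form_swap ω a c]
  ring

theorem form_smul_right (r : ℝ) (a c : V) : ω ![a, r • c] = r * ω ![a, c] := by
  rw [form_swap, form_smul_left, form_swap ω a c]
  ring

/-- The symplectic Lie algebra
`sp(V, ω) = {A ∈ gl(V) | ω(Ax, y) + ω(x, Ay) = 0 for all x, y}`. -/
def sp : Submodule ℝ (V →L[ℝ] V) where
  carrier := {A | ∀ x y : V, ω ![A x, y] + ω ![x, A y] = 0}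
  add_mem' := by
    intro A B hA hB x y
    have h1 := hA x y
    have h2 := hB x y
    simp only [add_apply, form_add_left, form_add_right]
    linarith
  zero_mem' := by
    intro x y
    have h1 := form_smul_left ω 0 0 y
    have h2 := form_smul_right ω 0 x 0
    simp only [zero_smul, zero_mul] at h1 h2
    simp [h1, h2]
  smul_mem' := by
    intro r A hA x y
    have h1 := hA x y
    simp only [smul_apply, form_smul_left, form_smul_right]
    rw [← mul_add, h1, mul_zero]

/-- `sp(V, ω)` is closed under the commutator bracket of `gl(V)`. -/
theorem commutator_mem_sp {A B : V →L[ℝ] V} (hA : A ∈ sp ω) (hB : B ∈ sp ω) :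
    A * B - B * A ∈ sp ω := by
  intro x y
  have h1 := hA (B x) y
  have h2 := hB (A x) y
  have h3 := hA x (B y)
  have h4 := hB x (A y)
  have e1 : (A * B - B * A) x = A (B x) + (-1 : ℝ) • B (A x) := by
    simp [sub_eq_add_neg]
  have e2 : (A * B - B * A) y = A (B y) + (-1 : ℝ) • B (A y) := by
    simp [sub_eq_add_neg]
  rw [e1, e2]
  simp only [form_add_left, form_add_right, form_smul_left, form_smul_right]
  linarith

/-- The action of an endomorphism on `ω`: `(A·ω)(x, y) = ω(Ax, y) + ω(x, Ay)`. -/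
def actAlt (A : V →L[ℝ] V) : V [⋀^Fin 2]→L[ℝ] ℝ where
  toFun v := ω ![A (v 0), v 1] + ω ![v 0, A (v 1)]
  map_update_add' := by
    intro inst m i x y
    cases Subsingleton.elim inst (instDecidableEqFin 2)
    fin_cases i <;> simp [form_add_left, form_add_right] <;> ring
  map_update_smul' := by
    intro inst m i c x
    cases Subsingleton.elim inst (instDecidableEqFin 2)
    fin_cases i <;> simp [form_smul_left, form_smul_right] <;> ring
  map_eq_zero_of_eq' := by
    intro v i j hij hne
    have h : v 0 = v 1 := by
      fin_cases i <;> fin_cases j <;> simp_all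
    simp only [h]
    rw [form_swap]
    ring
  cont := by
    have h1 : Continuous fun v : Fin 2 → V => ω ![A (v 0), v 1] :=
      ω.cont.comp (continuous_pi fun i => by fin_cases i <;> simp <;> fun_prop)
    have h2 : Continuous fun v : Fin 2 → V => ω ![v 0, A (v 1)] :=
      ω.cont.comp (continuous_pi fun i => by fin_cases i <;> simp <;> fun_prop)
    exact h1.add h2

/-- `A·ω` as an element of `⋀² V*`. -/
def actForm (A : V →L[ℝ] V) : TwoForm V := actAlt ω A

theorem actForm_apply (A : V →L[ℝ] V) (v : Fin 2 → V) :
    actForm ω A v = ω ![A (v 0), v 1] + ω ![v 0, A (v 1)] := rfl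

theorem actForm_eq_zero_iff (A : V →L[ℝ] V) : actForm ω A = 0 ↔ A ∈ sp ω := by
  constructor
  · intro h x y
    have := congrArg (fun g : TwoForm V => g ![x, y]) h
    simpa [actForm_apply, TwoForm.zero_apply] using this
  · intro h
    ext v
    exact h (v 0) (v 1)

variable [FiniteDimensional ℝ V]

/-- `A ↦ A·ω` as a linear map `gl(V) → ⋀² V*`. -/
noncomputable def act : (V →L[ℝ] V) →L[ℝ] TwoForm V :=
  LinearMap.toContinuousLinearMap
    { toFun := actForm ω
      map_add' := by
        intro A B
        ext v
        simp only [actForm_apply, add_apply, form_add_left, form_add_right,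
          TwoForm.add_apply]
        ring
      map_smul' := by
        intro r A
        ext v
        simp only [actForm_apply, smul_apply, form_smul_left, form_smul_right,
          TwoForm.smul_apply, RingHom.id_apply]
        ring }

theorem act_apply (A : V →L[ℝ] V) (v : Fin 2 → V) :
    act ω A v = ω ![A (v 0), v 1] + ω ![v 0, A (v 1)] := rfl

/-- The map `φ^ω_{p+1} : ⋀^{p+1} V* ⊗ V → ⋀^p V* ⊗ ⋀² V*`, that is
`φ^ω_{p+1}(ψ)(v₁, …, v_p) = ψ(v₁, …, v_p, -)·ω`, see `phi_apply`. It is written here with `-` in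
the first slot and the sign `(-1)^p`, as in
`φ^ω_{p+1}(α ⊗ X) = (-1)^p ι_{e_i} α ⊗ e^i ∧ ι_X ω`. -/
noncomputable def phi (p : ℕ) :
    (V [⋀^Fin (p + 1)]→L[ℝ] V) →ₗ[ℝ] (V [⋀^Fin p]→L[ℝ] TwoForm V) where
  toFun ψ := (-1 : ℝ) ^ p • (act ω).compContinuousAlternatingMap ψ.curryLeft.flipAlternating
  map_add' ψ χ := by
    ext v y
    have h := congrArg (fun g => g y) (map_add (act ω) (ψ.curryLeft.flipAlternating v)
      (χ.curryLeft.flipAlternating v))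
    exact (congrArg (fun t => (-1 : ℝ) ^ p * t) h).trans (mul_add _ _ _)
  map_smul' r ψ := by
    ext v y
    have h := congrArg (fun g => g y) (map_smul (act ω) r (ψ.curryLeft.flipAlternating v))
    exact (congrArg (fun t => (-1 : ℝ) ^ p * t) h).trans (mul_left_comm _ _ _)

/-- `φ^ω_{p+1}(ψ)(v₁, …, v_p) = ψ(v₁, …, v_p, -)·ω`. -/
theorem phi_apply (p : ℕ) (ψ : V [⋀^Fin (p + 1)]→L[ℝ] V) (v : Fin p → V) (y : Fin 2 → V) :
    phi ω p ψ v y = ω ![ψ (Fin.snoc v (y 0)), y 1] + ω ![y 0, ψ (Fin.snoc v (y 1))] := by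
  have key : ∀ z : V, ψ (Fin.snoc v z) = (-1 : ℝ) ^ p • ψ (Matrix.vecCons z v) := by
    intro z
    have h := ψ.toAlternatingMap.map_insertNth (Fin.last p) z v
    rw [Fin.insertNth_last', Fin.val_last] at h
    rcases Nat.even_or_odd p with hp | hp
    · simp only [hp.neg_one_pow, one_smul] at h ⊢
      exact h
    · simp only [hp.neg_one_pow, neg_smul, one_smul] at h ⊢
      exact h
  rw [key, key, form_smul_left, form_smul_right, ← mul_add]
  rfl

/-- `φ^ω` anticommutes with the differentials `d = ι_x` and `∂ = -ι_x`. -/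
theorem phi_contract (p : ℕ) (x : V) (ψ : V [⋀^Fin (p + 1 + 1)]→L[ℝ] V) :
    phi ω p (contract (p + 1) x ψ) = contract p x (phi ω (p + 1) ψ) := by
  ext v y
  rw [contract_apply, phi_apply, phi_apply]
  simp only [contract_apply, Matrix.vecCons, Fin.cons_snoc_eq_snoc_cons]

theorem phi_one_injective (hω : Nondegenerate ω) : Function.Injective (phi ω 1) := by
  rw [← LinearMap.ker_eq_bot, LinearMap.ker_eq_bot']
  intro ψ hψ
  have e : ∀ a b : V, (Fin.snoc ![a] b : Fin 2 → V) = ![a, b] := by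
    intro a b
    ext i
    fin_cases i <;> rfl
  have h : ∀ a b c : V, ω ![ψ ![a, b], c] = ω ![ψ ![a, c], b] := by
    intro a b c
    have h1 := phi_apply ω 1 ψ ![a] ![b, c]
    rw [hψ] at h1
    change (0 : ℝ) = ω ![_, c] + ω ![b, _] at h1
    rw [form_swap ω b] at h1
    have e1 := e a b
    have e2 := e a c
    have h2 : (0 : ℝ) = ω ![ψ ![a, b], c] + -ω ![ψ ![a, c], b] := by
      rw [← e1, ← e2]
      exact h1
    linarith
  have hs : ∀ a b : V, ψ ![a, b] = (-1 : ℝ) • ψ ![b, a] := by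
    intro a b
    have h := ψ.toAlternatingMap.map_swap ![b, a] (i := 0) (j := 1) (by simp)
    rw [neg_one_smul]
    refine Eq.trans (congrArg ψ ?_) h
    ext i
    fin_cases i <;> simp
  have hs' : ∀ a b c : V, ω ![ψ ![a, b], c] = - ω ![ψ ![b, a], c] := by
    intro a b c
    rw [hs, form_smul_left]
    ring
  ext v
  have hv : v = ![v 0, v 1] := by
    ext i
    fin_cases i <;> rfl
  rw [hv]
  apply hω
  intro c
  have h1 := h (v 0) (v 1) c
  have h2 := hs' (v 0) c (v 1)
  have h3 := h c (v 0) (v 1)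
  have h4 := hs' c (v 1) (v 0)
  have h5 := h (v 1) c (v 0)
  have h6 := hs' (v 0) (v 1) c
  linarith

theorem phi_one_bijective (hω : Nondegenerate ω) : Function.Bijective (phi ω 1) := by
  have hi := phi_one_injective ω hω
  refine ⟨hi, ?_⟩
  let e : (V →L[ℝ] ℝ) ≃ₗ[ℝ] V :=
    LinearEquiv.ofFinrankEq _ _ ((LinearMap.toContinuousLinearMap.finrank_eq).symm.trans
      (Subspace.dual_finrank_eq))
  let j : (V [⋀^Fin 1]→L[ℝ] TwoForm V) →ₗ[ℝ] (V [⋀^Fin 2]→L[ℝ] V) :=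
    { toFun := fun S => (e : (V →L[ℝ] ℝ) →ₗ[ℝ] V).toContinuousLinearMap.compContinuousAlternatingMap
        (((ContinuousAlternatingMap.ofSubsingletonLIE (𝕜 := ℝ) (E := V)
          (F := TwoForm V) (0 : Fin 1)).symm S).flipAlternating)
      map_add' := by
        intro S T
        ext1 v
        exact map_add e (((ContinuousAlternatingMap.ofSubsingletonLIE (𝕜 := ℝ) (E := V)
          (F := TwoForm V) (0 : Fin 1)).symm S).flipAlternating v)
          (((ContinuousAlternatingMap.ofSubsingletonLIE (𝕜 := ℝ) (E := V)
          (F := TwoForm V) (0 : Fin 1)).symm T).flipAlternating v)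
      map_smul' := by
        intro r S
        ext1 v
        exact map_smul e r (((ContinuousAlternatingMap.ofSubsingletonLIE (𝕜 := ℝ) (E := V)
          (F := TwoForm V) (0 : Fin 1)).symm S).flipAlternating v) }
  have hj : Function.Injective j := by
    intro S T h
    apply (ContinuousAlternatingMap.ofSubsingletonLIE (𝕜 := ℝ) (E := V)
          (F := TwoForm V) (0 : Fin 1)).symm.injective
    ext z v
    have h1 := congrArg (fun g : V [⋀^Fin 2]→L[ℝ] V => g v) h
    have h2 := e.injective h1
    exact congrArg (fun g : V →L[ℝ] ℝ => g z) h2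
  exact (LinearMap.injective_iff_surjective_of_finrank_eq_finrank
    (le_antisymm (LinearMap.finrank_le_finrank_of_injective hi)
      (LinearMap.finrank_le_finrank_of_injective hj))).1 hi

/-- The isomorphism `φ^ω_2 : ⋀² V* ⊗ V ≃ V* ⊗ ⋀² V*`. -/
noncomputable def phiTwo (hω : Nondegenerate ω) :
    (V [⋀^Fin 2]→L[ℝ] V) ≃ₗ[ℝ] (V [⋀^Fin 1]→L[ℝ] TwoForm V) :=
  LinearEquiv.ofBijective (phi ω 1) (phi_one_bijective ω hω)

instance isClosed_range_phi (p : ℕ) : IsClosed ((LinearMap.range (phi ω p) :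
    Submodule ℝ (V [⋀^Fin p]→L[ℝ] TwoForm V)) :
      Set (V [⋀^Fin p]→L[ℝ] TwoForm V)) :=
  Submodule.closed_of_finiteDimensional _

/-- `C_{p+1} = coker(φ^ω_{p+1})`, a quotient of `⋀^p V* ⊗ ⋀² V*`. -/
abbrev Coker (p : ℕ) : Type _ :=
  (V [⋀^Fin p]→L[ℝ] TwoForm V) ⧸ LinearMap.range (phi ω p)

/-- `φ^ω_{p+1} d_{p+2} + ∂_{p+1} φ^ω_{p+2} = 0`. -/
theorem del_phi (p : ℕ) (x : V) (ψ : V [⋀^Fin (p + 1 + 1)]→L[ℝ] V) :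
    del p x (phi ω (p + 1) ψ) = - phi ω p (contract (p + 1) x ψ) := by
  rw [phi_contract]
  rfl

/-- The value at `x` of the differential induced by `∂_{p+1}` on cokernels,
`[τ] ↦ [∂_{p+1} τ]`. -/
noncomputable def delBarAt (p : ℕ) (x : V) : Coker ω (p + 1) →ₗ[ℝ] Coker ω p :=
  Submodule.mapQ _ _ (del p x) (by
    rintro _ ⟨ψ, rfl⟩
    exact ⟨- contract (p + 1) x ψ, by rw [map_neg, del_phi]⟩)

/-- A smooth section of a quotient of the fibre lifts to a smooth section. -/
theorem exists_lift (p : ℕ) {f : V → Coker ω p} (hf : ContDiff ℝ (⊤ : ℕ∞) f) :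
    ∃ g : V → V [⋀^Fin p]→L[ℝ] TwoForm V, ContDiff ℝ (⊤ : ℕ∞) g ∧
      f = fun x => Submodule.Quotient.mk (g x) := by
  obtain ⟨s, hs⟩ := (Submodule.mkQ (LinearMap.range (phi ω p))).exists_rightInverse_of_surjective
    (Submodule.range_mkQ _)
  refine ⟨fun x => s (f x), linear_smooth (Coker ω p) (V [⋀^Fin p]→L[ℝ] TwoForm V) s hf, ?_⟩
  ext x
  exact (LinearMap.congr_fun hs (f x)).symm

theorem mk_smooth (p : ℕ) {g : V → V [⋀^Fin p]→L[ℝ] TwoForm V}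
    (hg : ContDiff ℝ (⊤ : ℕ∞) g) :
    ContDiff ℝ (⊤ : ℕ∞) (fun x => (Submodule.Quotient.mk (g x) : Coker ω p)) :=
  linear_smooth (V [⋀^Fin p]→L[ℝ] TwoForm V) (Coker ω p)
    (Submodule.mkQ (LinearMap.range (phi ω p))) hg

/-- The induced differential on sections of the cokernels: with `C_i = coker(φ^ω_i)`, this is
`∂̄_{p+1} : Γ(C_{p+2}) → Γ(C_{p+1})`. -/
noncomputable def delBar (p : ℕ) : Sec V (Coker ω (p + 1)) →ₗ[Fun V] Sec V (Coker ω p) :=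
  secMap (delBarAt ω p) (by
    intro f hf
    obtain ⟨g, hg, rfl⟩ := exists_lift ω (p + 1) hf
    exact mk_smooth ω p (del_smooth p hg))

/-- The value at `x` of `d_2 (φ^ω_2)⁻¹ ∂_2 : Γ(⋀² V* ⊗ ⋀² V*) → Γ(gl(V))`. -/
noncomputable def connectGl (hω : Nondegenerate ω) (x : V) :
    (V [⋀^Fin 2]→L[ℝ] TwoForm V) →ₗ[ℝ] (V →L[ℝ] V) :=
  toEnd.toLinearEquiv.toLinearMap ∘ₗ contract 1 x ∘ₗ
    (phiTwo ω hω).symm.toLinearMap ∘ₗ del 1 x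

theorem phi_zero_apply (ψ : V [⋀^Fin 1]→L[ℝ] V) (v : Fin 0 → V) :
    phi ω 0 ψ v = actForm ω (toEnd ψ) := by
  ext y
  rw [phi_apply, actForm_apply, toEnd_apply, toEnd_apply]
  have e : ∀ z : V, (Fin.snoc v z : Fin 1 → V) = ![z] := by
    intro z
    ext i
    fin_cases i
    rfl
  have e1 := e (y 0)
  have e2 := e (y 1)
  rw [← e1, ← e2]

/-- `d_2 (φ^ω_2)⁻¹ ∂_2` takes values in `sp(V, ω)`. -/
theorem connectGl_mem (hω : Nondegenerate ω) (x : V)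
    (τ : V [⋀^Fin 2]→L[ℝ] TwoForm V) : connectGl ω hω x τ ∈ sp ω := by
  rw [← actForm_eq_zero_iff]
  have h : connectGl ω hω x τ = toEnd (contract 1 x ((phiTwo ω hω).symm (del 1 x τ))) := rfl
  rw [h, ← phi_zero_apply ω _ ![], phi_contract]
  have h2 : phi ω 1 ((phiTwo ω hω).symm (del 1 x τ)) = del 1 x τ :=
    (phiTwo ω hω).apply_symm_apply _
  have h3 := del_del 0 x τ
  have h4 : contract 0 x (del 1 x τ) = - del 0 x (del 1 x τ) := by
    simp [del]
  change contract 0 x (phi ω 1 ((phiTwo ω hω).symm (del 1 x τ))) ![] = 0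
  rw [h2, h4, h3, neg_zero]
  rfl

/-- `d_2 (φ^ω_2)⁻¹ ∂_2` vanishes on the image of `φ^ω_3`. -/
theorem connectGl_phi (hω : Nondegenerate ω) (x : V) (ψ : V [⋀^Fin 3]→L[ℝ] V) :
    connectGl ω hω x (phi ω 2 ψ) = 0 := by
  have h : connectGl ω hω x (phi ω 2 ψ) =
    toEnd (contract 1 x ((phiTwo ω hω).symm (del 1 x (phi ω 2 ψ)))) := rfl
  have h1 : del 1 x (phi ω 2 ψ) = phiTwo ω hω (- contract 2 x ψ) := by
    rw [map_neg]
    exact del_phi ω 1 x ψ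
  rw [h, h1, LinearEquiv.symm_apply_apply, map_neg, contract_contract, neg_zero, map_zero]

/-- The value at `x` of the map induced by `d_2 (φ^ω_2)⁻¹ ∂_2`, from `C_3` to `sp(V, ω)`. -/
noncomputable def connectAt (hω : Nondegenerate ω) (x : V) : Coker ω 2 →ₗ[ℝ] sp ω :=
  Submodule.liftQ _ ((connectGl ω hω x).codRestrict (sp ω) (connectGl_mem ω hω x)) (by
    rintro _ ⟨ψ, rfl⟩
    exact Subtype.ext (connectGl_phi ω hω x ψ))

theorem sp_smooth {f : V → sp ω} (hf : ContDiff ℝ (⊤ : ℕ∞) (fun x => (f x : V →L[ℝ] V))) :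
    ContDiff ℝ (⊤ : ℕ∞) f := by
  obtain ⟨r, hr⟩ := (sp ω).subtype.exists_leftInverse_of_injective (Submodule.ker_subtype _)
  have h := linear_smooth (V →L[ℝ] V) (sp ω) r hf
  convert h using 1
  ext1 x
  exact (LinearMap.congr_fun hr (f x)).symm

/-- The map `d_2 (φ^ω_2)⁻¹ ∂_2 : Γ(C_3) → Γ(sp(V, ω))`. -/
noncomputable def connect (hω : Nondegenerate ω) : Sec V (Coker ω 2) →ₗ[Fun V] Sec V (sp ω) :=
  secMap (connectAt ω hω) (by
    intro f hf
    obtain ⟨g, hg, rfl⟩ := exists_lift ω 2 hf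
    apply sp_smooth
    have h1 := linear_smooth (V [⋀^Fin 1]→L[ℝ] TwoForm V) (V [⋀^Fin 2]→L[ℝ] V)
      (phiTwo ω hω).symm.toLinearMap (del_smooth 1 hg)
    have h2 := contract_smooth 1 h1
    exact linear_smooth (V [⋀^Fin 1]→L[ℝ] V) (V →L[ℝ] V)
      (toEnd (V := V)).toLinearEquiv.toLinearMap h2)

end Symplectic

section Foliation

variable {V : Type*} [NormedAddCommGroup V] [NormedSpace ℝ V]
variable (ω : V [⋀^Fin 2]→L[ℝ] ℝ)

/-- The anchor `ρ` on `Γ(sp(V, ω))`, contraction with the Euler vector field: it maps a section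
`A` to the vector field `x ↦ A(x) x`. -/
noncomputable def anchor : Sec V (sp ω) →ₗ[Fun V] Sec V V :=
  secMap (fun x => (LinearMap.applyₗ x ∘ₗ ContinuousLinearMap.coeLM ℝ) ∘ₗ (sp ω).subtype) (by
    intro f hf
    exact ((sp ω).subtypeL.contDiff.comp hf).clm_apply contDiff_id)

/-- The foliation `F_ω = ρ(Γ(sp(V, ω)))`, a `C^∞(V)`-module of vector fields on `V`. -/
noncomputable def foliation : Submodule (Fun V) (Sec V V) := LinearMap.range (anchor ω)

/-- The anchor as a map onto the foliation. -/
noncomputable def anchorOnto : Sec V (sp ω) →ₗ[Fun V] foliation ω :=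
  (anchor ω).rangeRestrict

theorem anchorOnto_apply (A : Sec V (sp ω)) (x : V) :
    (anchorOnto ω A : Sec V V) x = (A x : V →L[ℝ] V) x := rfl

end Foliation

end LinearSymplectic

/-! The maps `phi` join two Koszul complexes of the Euler vector field, one with coefficients in V
and one in ⋀²V*, whose differentials d and ∂ anticommute with φ. Three facts make the resolution a
diagram chase. Each Koszul complex is exact in positive form degree (`exists_contract_eq`), by the
radial homotopy of the Poincaré lemma. The fibre maps φ_p are injective for p ≥ 2
(`phi_succ_injective`), φ_2 is bijective, and the kernel of φ_1 is sp(V, ω). Finally, φ does not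
depend on the point of V, so linear splittings in the fibre carry smooth families to smooth
families.

If the class of τ is a cycle in the cokernel complex, then ∂τ = φψ and φ(dψ) = -∂∂τ = 0, so dψ = 0
and ψ = dχ. Then τ + φχ is a ∂-cycle with the same class, hence equal to some ∂σ
(`exists_mk_eq_delBarAt`). At Γ(C_3) the form ψ is φ_2⁻¹∂τ, and dψ = 0 is the kernel condition
itself. At Γ(sp) the anchor is the Koszul differential d_1: a section A in its kernel is some dψ,
and φ_1 A = 0 makes φ_2 ψ a ∂-cycle, hence some ∂τ.

Projectivity holds because a basis of the fibre is a basis of the module of sections. -/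

namespace LinearSymplectic

open scoped ContDiff

/-! ### Exactness of the Koszul complex of the Euler vector field. -/

section Koszul

universe u

/-- The integral over `[0, 1]` of a smooth family of smooth maps is smooth. -/
theorem contDiff_parametric_intervalIntegral {V : Type u} [NormedAddCommGroup V] [NormedSpace ℝ V]
    [FiniteDimensional ℝ V] (n : ℕ) :
    ∀ {B : Type u} [NormedAddCommGroup B] [NormedSpace ℝ B] [FiniteDimensional ℝ B]
      {F : V × ℝ → B}, ContDiff ℝ ∞ F → ContDiff ℝ n (fun x => ∫ t in (0 : ℝ)..1, F (x, t)) := by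
  -- The codomain `B` varies in the induction, since the derivative under the integral has values in
  -- `V →L[ℝ] B`; this is why `V` and `B` share a universe.
  induction n with
  | zero =>
    intro B _ _ _ F hF
    exact contDiff_zero.2 (intervalIntegral.continuous_parametric_intervalIntegral_of_continuous'
      (f := fun x t => F (x, t)) hF.continuous 0 1)
  | succ n ih =>
    intro B _ _ _ F hF
    have hG : ContDiff ℝ ∞ (fun z => (fderiv ℝ F z).comp (ContinuousLinearMap.inl ℝ V ℝ)) :=
      (hF.fderiv_right (m := ∞) le_rfl).clm_comp contDiff_const
    have hGF : ∀ x t, HasFDerivAt (fun x => F (x, t))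
        ((fderiv ℝ F (x, t)).comp (ContinuousLinearMap.inl ℝ V ℝ)) x := fun x t =>
      ((hF.differentiable (by simp)) (x, t)).hasFDerivAt.comp x (hasFDerivAt_prodMk_left x t)
    refine contDiff_succ_iff_hasFDerivAt.2 ⟨_, ih hG, fun x => ?_⟩
    have hcont : ∀ y, Continuous fun t => F (y, t) := fun y =>
      hF.continuous.comp (Continuous.prodMk_right y)
    obtain ⟨C, hC⟩ := ((isCompact_closedBall x 1).prod
      (isCompact_Icc (a := (0 : ℝ)) (b := 1))).exists_bound_of_continuousOn
        hG.continuous.continuousOn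
    refine intervalIntegral.hasFDerivAt_integral_of_dominated_of_fderiv_le
      (F := fun x t => F (x, t)) (bound := fun _ => C)
      (F' := fun x t => (fderiv ℝ F (x, t)).comp (ContinuousLinearMap.inl ℝ V ℝ))
      (Metric.closedBall_mem_nhds x one_pos)
      (Filter.Eventually.of_forall fun y => (hcont y).aestronglyMeasurable)
      ((hcont x).intervalIntegrable _ _)
      (hG.continuous.comp (Continuous.prodMk_right x)).aestronglyMeasurable
      (Filter.Eventually.of_forall fun t ht y hy => hC (y, t) ⟨hy, ?_⟩)
      intervalIntegrable_const
      (Filter.Eventually.of_forall fun t _ y _ => hGF y t)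
    rw [Set.uIoc_of_le zero_le_one] at ht
    exact Set.Ioc_subset_Icc_self ht

variable {V A : Type u} [NormedAddCommGroup V] [NormedSpace ℝ V]
  [NormedAddCommGroup A] [NormedSpace ℝ A]

/-- Cartan's formula for the Euler vector field, on forms annihilated by the contraction with it. -/
theorem contract_extDeriv {p : ℕ} {ψ : V → V [⋀^Fin (p + 1)]→L[ℝ] A} (hψ : ContDiff ℝ ∞ ψ)
    (h : ∀ x, contract p x (ψ x) = 0) (x : V) :
    contract (p + 1) x (extDeriv ψ x) = fderiv ℝ ψ x x + ((p : ℝ) + 1) • ψ x := by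
  have hd : HasFDerivAt ψ (fderiv ℝ ψ x) x := ((hψ.differentiable (by simp)) x).hasFDerivAt
  -- Differentiate the identity ι_z ψ(z) = 0 at z = x in the direction y.
  have key : ∀ (y : V) (w : Fin p → V),
      fderiv ℝ ψ x y (Matrix.vecCons x w) = - ψ x (Matrix.vecCons y w) := by
    intro y w
    let L : (V [⋀^Fin (p + 1)]→L[ℝ] A) →L[ℝ] (V →L[ℝ] V [⋀^Fin p]→L[ℝ] A) :=
      ContinuousAlternatingMap.curryLeftLI.toContinuousLinearMap
    have h0 : HasFDerivAt (fun z => L (ψ z)) (L.comp (fderiv ℝ ψ x)) x :=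
      HasFDerivAt.comp (F := V [⋀^Fin (p + 1)]→L[ℝ] A) (G := V →L[ℝ] V [⋀^Fin p]→L[ℝ] A) x
        L.hasFDerivAt hd
    have h1 := h0.clm_apply (hasFDerivAt_id x)
    have h2 : (fun z => L (ψ z) (id z)) = fun _ => 0 := funext h
    rw [h2] at h1
    have h3 := h1.unique (hasFDerivAt_const 0 x)
    have h4 := congrArg (fun L : V →L[ℝ] V [⋀^Fin p]→L[ℝ] A => L y w) h3
    have h5 : ψ x (Matrix.vecCons y w) + fderiv ℝ ψ x y (Matrix.vecCons x w) = 0 := h4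
    exact eq_neg_of_add_eq_zero_right h5
  ext v
  rw [contract_apply, extDeriv, ContinuousAlternatingMap.alternatizeUncurryFin_apply,
    Fin.sum_univ_succ]
  -- Apart from the derivative along x, each of the p + 1 terms equals ψ(v): the sign from `key` and
  -- the (-1)^j from moving v_j back to its slot cancel (-1)^(j+1).
  have h0 : ∀ j : Fin (p + 1), (-1 : ℤ) ^ (j.succ : ℕ) • fderiv ℝ ψ x
      ((Matrix.vecCons x v : Fin (p + 2) → V) j.succ)
        (j.succ.removeNth (Matrix.vecCons x v)) = ψ x v := by
    intro j
    have e : j.succ.removeNth (Matrix.vecCons x v : Fin (p + 2) → V) =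
        Matrix.vecCons x (j.removeNth v) := by
      ext1 i
      refine Fin.cases ?_ (fun i => ?_) i <;> simp [Fin.removeNth]
    have h6 := (ψ x).neg_one_pow_smul_map_insertNth j (v j) (j.removeNth v)
    rw [Fin.insertNth_self_removeNth] at h6
    rw [e, Matrix.cons_val_succ, key, ← h6, Fin.val_succ]
    rcases Nat.even_or_odd (j : ℕ) with hj | hj
    · simp [pow_succ, hj.neg_one_pow]
    · simp [pow_succ, hj.neg_one_pow]
  simp only [h0, Finset.sum_const, Finset.card_univ, Fintype.card_fin, ← Nat.cast_smul_eq_nsmul ℝ]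
  simp

/-- Exactness in positive degrees of the Koszul complex of smooth forms with the contraction with
the Euler vector field. -/
theorem exists_contract_eq [FiniteDimensional ℝ V] [FiniteDimensional ℝ A] {p : ℕ}
    {ψ : V → V [⋀^Fin (p + 1)]→L[ℝ] A} (hψ : ContDiff ℝ ∞ ψ)
    (h : ∀ x, contract p x (ψ x) = 0) :
    ∃ χ : V → V [⋀^Fin (p + 1 + 1)]→L[ℝ] A, ContDiff ℝ ∞ χ ∧
      ∀ x, contract (p + 1) x (χ x) = ψ x := by
  have hfψ : ContDiff ℝ ∞ (fderiv ℝ ψ) := hψ.fderiv_right le_rfl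
  have hdψ : ContDiff ℝ ∞ (extDeriv ψ) := ContDiff.continuousLinearMap_comp
    (ContinuousAlternatingMap.alternatizeUncurryFinCLM ℝ V A (n := p + 1)) hfψ
  have hF : ContDiff ℝ ∞ (fun z : V × ℝ => z.2 ^ (p + 1) • extDeriv ψ (z.2 • z.1)) :=
    (contDiff_snd.pow _).smul (hdψ.comp (contDiff_snd.smul contDiff_fst))
  -- By Cartan's formula at tx, and ι_{tx} = t ι_x, the contraction of the integrand with x is the
  -- derivative of t ↦ t^(p+1) ψ(tx). This function is ψ(x) at t = 1 and vanishes at t = 0 because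
  -- the degree p + 1 is positive.
  refine ⟨fun x => ∫ t in (0 : ℝ)..1, t ^ (p + 1) • extDeriv ψ (t • x),
    contDiff_infty.2 fun n => contDiff_parametric_intervalIntegral n hF, fun x => ?_⟩
  have hc : Continuous fun t : ℝ => t ^ (p + 1) • extDeriv ψ (t • x) :=
    hF.continuous.comp (Continuous.prodMk_right x)
  let L := LinearMap.toContinuousLinearMap (contract (A := A) (p + 1) x)
  have h1 := L.intervalIntegral_comp_comm (hc.intervalIntegrable (μ := MeasureTheory.volume) 0 1)
  have hder : ∀ t : ℝ, HasDerivAt (fun t : ℝ => t ^ (p + 1) • ψ (t • x))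
      (L (t ^ (p + 1) • extDeriv ψ (t • x))) t := by
    intro t
    have h2 : HasDerivAt (fun t : ℝ => ψ (t • x)) (fderiv ℝ ψ (t • x) x) t := by
      have h3 := ((hψ.differentiable (by simp)) (t • x)).hasFDerivAt.comp_hasDerivAt t
        ((hasDerivAt_id t).smul_const x)
      rw [one_smul] at h3
      exact h3
    refine ((hasDerivAt_pow (p + 1) t).smul h2).congr_deriv ?_
    have h5 : L (extDeriv ψ (t • x)) = contract (p + 1) x (extDeriv ψ (t • x)) := rfl
    have h6 := contract_extDeriv hψ h (t • x)
    have h7 : contract (p + 1) (t • x) (extDeriv ψ (t • x)) =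
        t • contract (p + 1) x (extDeriv ψ (t • x)) :=
      map_smul (extDeriv ψ (t • x)).curryLeft t x
    rw [map_smul, h5, pow_succ, mul_smul (t ^ p) t (contract _ _ _), ← h7, h6, map_smul, smul_add, mul_smul,
      smul_smul (t ^ p) ((p : ℝ) + 1)]
    simp [mul_comm]
  have h8 := intervalIntegral.integral_eq_sub_of_hasDerivAt (a := 0) (b := 1)
    (fun t _ => hder t) ((L.continuous.comp hc).intervalIntegrable _ _)
  have h9 : contract (p + 1) x (∫ t in (0 : ℝ)..1, t ^ (p + 1) • extDeriv ψ (t • x)) =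
    L (∫ t in (0 : ℝ)..1, t ^ (p + 1) • extDeriv ψ (t • x)) := rfl
  simp only [h9, ← h1, h8]
  simp

end Koszul

end LinearSymplectic

namespace LinearSymplectic

/-! ### Projectivity of the modules of sections. -/

section Resolution

universe u

variable {V : Type u} [NormedAddCommGroup V] [NormedSpace ℝ V]

/-- Smooth sections of a trivial bundle with finite-dimensional fibre form a free module. -/
noncomputable def secEquivFun {A : Type*} [NormedAddCommGroup A] [NormedSpace ℝ A]
    [FiniteDimensional ℝ A] {ι : Type*} [Fintype ι] (b : Module.Basis ι ℝ A) :
    Sec V A ≃ₗ[Fun V] (ι → Fun V) where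
  toFun f i := ⟨fun x => b.coord i (f x),
    (linear_smooth A ℝ (b.coord i) f.contMDiff.contDiff).contMDiff⟩
  invFun c := ⟨fun x => ∑ i, c i x • b i,
    (ContDiff.sum fun i _ => (c i).contMDiff.contDiff.smul contDiff_const).contMDiff⟩
  map_add' f g := by
    ext i x
    exact map_add (b.coord i) (f x) (g x)
  map_smul' c f := by
    ext i x
    exact map_smul (b.coord i) (c x) (f x)
  left_inv f := by
    ext x
    exact b.sum_repr (f x)
  right_inv c := by
    ext i x
    have h := congrFun (b.equivFun.apply_symm_apply fun i => c i x) i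
    rw [Module.Basis.equivFun_symm_apply] at h
    exact h

theorem projective_sec (A : Type*) [NormedAddCommGroup A] [NormedSpace ℝ A]
    [FiniteDimensional ℝ A] : Module.Projective (Fun V) (Sec V A) :=
  Module.Projective.of_equiv (secEquivFun (V := V) (Module.finBasis ℝ A)).symm

/-- This is d_1 d_2 = 0: evaluating an endomorphism at x is contracting the corresponding one-form
with x. -/
theorem toEnd_contract_apply_self (x : V) (χ : V [⋀^Fin 2]→L[ℝ] V) :
    toEnd (contract 1 x χ) x = 0 := by
  rw [toEnd_apply]
  exact congrArg (fun α : V [⋀^Fin 0]→L[ℝ] V => α ![]) (contract_contract 0 x χ)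

/-! ### Linear algebra of φ in the fibres. -/

variable (ω : V [⋀^Fin 2]→L[ℝ] ℝ) [FiniteDimensional ℝ V]

theorem subsingleton_coker {p : ℕ} (hp : Module.finrank ℝ V < p) :
    Subsingleton (Coker ω p) := by
  have : Subsingleton (V [⋀^Fin p]→L[ℝ] TwoForm V) := by
    refine subsingleton_of_forall_eq 0 fun τ => ?_
    ext v : 1
    refine τ.toAlternatingMap.map_linearDependent v fun hv => ?_
    have := hv.fintype_card_le_finrank
    rw [Fintype.card_fin] at this
    omega
  exact (Submodule.mkQ_surjective _).subsingleton

/-- Contraction with any fixed vector commutes with φ, and a form of positive degree is zero once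
all its contractions are; so injectivity climbs from `phi ω 1`. It cannot start at `phi ω 0`, whose
kernel is sp(V, ω). -/
theorem phi_succ_injective (hω : Nondegenerate ω) (p : ℕ) :
    Function.Injective (phi ω (p + 1)) := by
  induction p with
  | zero => exact phi_one_injective ω hω
  | succ p ih =>
    refine (injective_iff_map_eq_zero _).2 fun ψ hψ => ?_
    ext v
    have h : contract (p + 1 + 1) (v 0) ψ = 0 := ih (by rw [phi_contract, hψ, map_zero, map_zero])
    have h1 := congrArg (fun χ : V [⋀^Fin (p + 1 + 1)]→L[ℝ] V => χ (Matrix.vecTail v)) h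
    rw [← Matrix.cons_head_tail v]
    exact h1

/-- A smooth family in the image of `φ^ω` is the image of a smooth family. -/
theorem exists_phi_eq (p : ℕ) {τ : V → V [⋀^Fin p]→L[ℝ] TwoForm V} (hτ : ContDiff ℝ (⊤ : ℕ∞) τ)
    (h : ∀ x, τ x ∈ LinearMap.range (phi ω p)) :
    ∃ ψ : V → V [⋀^Fin (p + 1)]→L[ℝ] V, ContDiff ℝ (⊤ : ℕ∞) ψ ∧ ∀ x, phi ω p (ψ x) = τ x := by
  -- A linear section of φ over its range, extended to the whole fibre, is constant in x and so
  -- preserves smoothness.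
  obtain ⟨s, hs⟩ := (phi ω p).rangeRestrict.exists_rightInverse_of_surjective
    (LinearMap.range_rangeRestrict _)
  obtain ⟨g, hg⟩ := s.exists_extend
  refine ⟨fun x => g (τ x), linear_smooth _ _ g hτ, fun x => ?_⟩
  have h1 : g (τ x) = s ⟨τ x, h x⟩ := LinearMap.congr_fun hg ⟨τ x, h x⟩
  change phi ω p (g (τ x)) = τ x
  rw [h1]
  exact congrArg Subtype.val (LinearMap.congr_fun hs ⟨τ x, h x⟩)

/-! ### The diagram chase. -/

/-- The diagram chase: a form whose differential is `φ^ω` of a Koszul cycle is exact modulo the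
image of `φ^ω`. -/
theorem exists_mk_eq_delBarAt (p : ℕ) {τ : V → V [⋀^Fin (p + 1)]→L[ℝ] TwoForm V}
    (hτ : ContDiff ℝ (⊤ : ℕ∞) τ) {ψ : V → V [⋀^Fin (p + 1)]→L[ℝ] V} (hψ : ContDiff ℝ (⊤ : ℕ∞) ψ)
    (h : ∀ x, del p x (τ x) = phi ω p (ψ x)) (h0 : ∀ x, contract p x (ψ x) = 0) :
    ∃ σ : V → V [⋀^Fin (p + 1 + 1)]→L[ℝ] TwoForm V, ContDiff ℝ (⊤ : ℕ∞) σ ∧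
      ∀ x, delBarAt ω (p + 1) x (Submodule.Quotient.mk (σ x)) = Submodule.Quotient.mk (τ x) := by
  obtain ⟨χ, hχ, hχψ⟩ := exists_contract_eq hψ h0
  -- The correction τ + φχ has the class of τ and is a ∂-cycle, since ∂φχ = -φdχ = -φψ. The outer
  -- minus sign turns a primitive for the contraction into one for ∂.
  have h1 : ∀ x, contract p x (-(τ x + phi ω (p + 1) (χ x))) = 0 := by
    intro x
    have h2 : del p x (τ x + phi ω (p + 1) (χ x)) = 0 := by
      rw [map_add, h, del_phi, hχψ, add_neg_cancel]
    rw [map_neg]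
    exact h2
  obtain ⟨σ, hσ, hσ'⟩ := exists_contract_eq
    ((hτ.add (linear_smooth _ _ (phi ω (p + 1)) hχ)).neg) h1
  refine ⟨σ, hσ, fun x => ?_⟩
  have h3 : del (p + 1) x (σ x) = τ x + phi ω (p + 1) (χ x) := by
    rw [del, LinearMap.neg_apply, hσ', neg_neg]
  have h4 : delBarAt ω (p + 1) x (Submodule.Quotient.mk (σ x)) =
    Submodule.Quotient.mk (del (p + 1) x (σ x)) := rfl
  rw [h4, h3, Submodule.Quotient.eq]
  exact ⟨χ x, by abel⟩

theorem delBarAt_delBarAt (p : ℕ) (x : V) (c : Coker ω (p + 1 + 1)) :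
    delBarAt ω p x (delBarAt ω (p + 1) x c) = 0 := by
  obtain ⟨τ, rfl⟩ := Submodule.Quotient.mk_surjective _ c
  exact congrArg Submodule.Quotient.mk (del_del p x τ)

theorem exact_delBar (hω : Nondegenerate ω) (p : ℕ) :
    Function.Exact (delBar ω (p + 1 + 1 + 1)) (delBar ω (p + 1 + 1)) := by
  intro f
  constructor
  · intro hf
    obtain ⟨τ, hτ, hfτ⟩ := exists_lift ω (p + 1 + 1 + 1) f.contMDiff.contDiff
    have h1 : ∀ x, del (p + 1 + 1) x (τ x) ∈ LinearMap.range (phi ω (p + 1 + 1)) := by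
      intro x
      have h2 : delBarAt ω (p + 1 + 1) x (f x) = 0 :=
        congrArg (fun g : Sec V (Coker ω (p + 1 + 1)) => g x) hf
      rw [congrFun hfτ x] at h2
      exact (Submodule.Quotient.mk_eq_zero _).1 h2
    obtain ⟨ψ, hψ, hψτ⟩ := exists_phi_eq ω (p + 1 + 1) (del_smooth (p + 1 + 1) hτ) h1
    -- That ψ is a Koszul cycle follows from φ(dψ) = -∂φψ = -∂∂τ = 0, with φ injective one degree
    -- lower; the lowest case uses `phi ω 1`.
    obtain ⟨σ, hσ, hστ⟩ := exists_mk_eq_delBarAt ω (p + 1 + 1) hτ hψ (fun x => (hψτ x).symm) (by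
      intro x
      apply phi_succ_injective ω hω p
      rw [map_zero, ← neg_eq_zero, ← del_phi, hψτ, del_del])
    refine ⟨⟨_, (mk_smooth ω _ hσ).contMDiff⟩, ?_⟩
    ext x
    exact (hστ x).trans (congrFun hfτ x).symm
  · rintro ⟨g, rfl⟩
    ext x
    exact delBarAt_delBarAt ω (p + 1 + 1) x (g x)

/-- Here dψ = 0 cannot come from injectivity, as it would concern `phi ω 0`. For ψ = φ_2⁻¹∂τ it is
instead exactly the vanishing of `connect` on the class of τ. -/
theorem exact_delBar_connect (hω : Nondegenerate ω) :
    Function.Exact (delBar ω 2) (connect ω hω) := by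
  intro f
  constructor
  · intro hf
    obtain ⟨τ, hτ, hfτ⟩ := exists_lift ω 2 f.contMDiff.contDiff
    obtain ⟨σ, hσ, hστ⟩ := exists_mk_eq_delBarAt ω 1 hτ
      (linear_smooth _ _ (phiTwo ω hω).symm.toLinearMap (del_smooth 1 hτ))
      (fun x => ((phiTwo ω hω).apply_symm_apply _).symm) (by
        intro x
        have h1 : connectAt ω hω x (f x) = 0 := congrArg (fun g : Sec V (sp ω) => g x) hf
        rw [congrFun hfτ x] at h1
        have h2 : toEnd (contract 1 x ((phiTwo ω hω).symm (del 1 x (τ x)))) = 0 :=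
          congrArg Subtype.val h1
        exact (map_eq_zero_iff _ toEnd.injective).1 h2)
    refine ⟨⟨_, (mk_smooth ω _ hσ).contMDiff⟩, ?_⟩
    ext x
    exact (hστ x).trans (congrFun hfτ x).symm
  · rintro ⟨g, rfl⟩
    ext x : 1
    obtain ⟨τ, hτ⟩ := Submodule.Quotient.mk_surjective _ (g x)
    have h1 : connectGl ω hω x (del 2 x τ) = 0 := by
      change toEnd (contract 1 x ((phiTwo ω hω).symm (del 1 x (del 2 x τ)))) = 0
      rw [del_del, map_zero, map_zero, map_zero]
    refine Subtype.ext ?_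
    change (connectAt ω hω x (delBarAt ω 2 x (g x)) : V →L[ℝ] V) = 0
    rw [← hτ]
    exact h1

theorem connectAt_apply_self (hω : Nondegenerate ω) (x : V) (c : Coker ω 2) :
    (connectAt ω hω x c : V →L[ℝ] V) x = 0 := by
  obtain ⟨τ, rfl⟩ := Submodule.Quotient.mk_surjective _ c
  exact toEnd_contract_apply_self x _

/-- Two Koszul primitives are taken in succession: A(x)x = 0 gives A = dψ, and then A ∈ sp(V, ω)
gives ∂φ_2 ψ = -φ_1 A = 0, so φ_2 ψ = ∂τ and A = d φ_2⁻¹ ∂τ. -/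
theorem exact_connect_anchorOnto (hω : Nondegenerate ω) :
    Function.Exact (connect ω hω) (anchorOnto ω) := by
  intro A
  constructor
  · intro hA
    have hA0 : ∀ x, (A x : V →L[ℝ] V) x = 0 := fun x =>
      congrArg (fun X : foliation ω => (X : Sec V V) x) hA
    have hAs : ContDiff ℝ (⊤ : ℕ∞) fun x => toEnd.symm (A x : V →L[ℝ] V) :=
      linear_smooth _ _ (toEnd (V := V)).symm.toLinearEquiv.toLinearMap
        (linear_smooth _ _ (sp ω).subtype A.contMDiff.contDiff)
    have h0 : ∀ x, contract 0 x (toEnd.symm (A x : V →L[ℝ] V)) = 0 := by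
      intro x
      ext v
      rw [contract_apply]
      have h1 := toEnd_apply (toEnd.symm (A x : V →L[ℝ] V)) x
      rw [LinearIsometryEquiv.apply_symm_apply, hA0] at h1
      rw [Subsingleton.elim v ![]]
      exact h1.symm
    obtain ⟨ψ, hψ, hψA⟩ := exists_contract_eq hAs h0
    have h1 : ∀ x, contract 0 x (-phi ω 1 (ψ x)) = 0 := by
      intro x
      rw [map_neg, ← phi_contract, hψA]
      ext v : 1
      have h2 := (actForm_eq_zero_iff ω _).2 (A x).2
      have h3 := phi_zero_apply ω (toEnd.symm (A x : V →L[ℝ] V)) v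
      rw [LinearIsometryEquiv.apply_symm_apply, h2] at h3
      exact neg_eq_zero.2 h3
    obtain ⟨τ, hτ, hτψ⟩ := exists_contract_eq (linear_smooth _ _ (phi ω 1) hψ).neg h1
    refine ⟨⟨_, (mk_smooth ω 2 hτ).contMDiff⟩, ?_⟩
    ext x : 1
    refine Subtype.ext ?_
    change toEnd (contract 1 x ((phiTwo ω hω).symm (del 1 x (τ x)))) = (A x : V →L[ℝ] V)
    have h2 : del 1 x (τ x) = phiTwo ω hω (ψ x) := by
      rw [del, LinearMap.neg_apply, hτψ, neg_neg]
      rfl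
    rw [h2, LinearEquiv.symm_apply_apply, hψA, LinearIsometryEquiv.apply_symm_apply]
  · rintro ⟨g, rfl⟩
    refine Subtype.ext ?_
    ext x
    exact connectAt_apply_self ω hω x (g x)

end Resolution

end LinearSymplectic

/-! ### Assembly of the resolution. -/

/-- The projective resolution of the foliation of the symplectic Lie algebra. With
`C_i = coker(φ^ω_i)` one has `Sec V (Coker ω p) = Γ(C_{p+1})` and `delBar ω p = ∂̄_{p+1}`. -/
theorem mainTheorem4 {V : Type*} [NormedAddCommGroup V] [NormedSpace ℝ V] [FiniteDimensional ℝ V]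
    (ω : V [⋀^Fin 2]→L[ℝ] ℝ) (hω : LinearSymplectic.Nondegenerate ω) :
    -- the modules are projective over `C^(⊤ : ℕ∞)(V)`
    (∀ p : ℕ, 2 ≤ p →
      Module.Projective (LinearSymplectic.Fun V)
        (LinearSymplectic.Sec V (LinearSymplectic.Coker ω p))) ∧
    Module.Projective (LinearSymplectic.Fun V)
      (LinearSymplectic.Sec V (LinearSymplectic.sp ω)) ∧
    -- `Γ(C_i) = 0` for `i ≥ n + 2`, where `n = dim V`: with the exactness below, the sequence ends
    -- on the left with `0 → Γ(C_{n+1})`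
    (∀ p : ℕ, Module.finrank ℝ V < p →
      Subsingleton (LinearSymplectic.Sec V (LinearSymplectic.Coker ω p))) ∧
    -- exactness at `Γ(C_{p+2})`, for all `p + 2 ≥ 4` (for `p + 2 = n + 1`: injectivity)
    (∀ p : ℕ, 2 ≤ p →
      Function.Exact (LinearSymplectic.delBar ω (p + 1)) (LinearSymplectic.delBar ω p)) ∧
    -- exactness at `Γ(C_3)`
    Function.Exact (LinearSymplectic.delBar ω 2) (LinearSymplectic.connect ω hω) ∧
    -- exactness at `Γ(sp(V, ω))`
    Function.Exact (LinearSymplectic.connect ω hω) (LinearSymplectic.anchorOnto ω) ∧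
    -- exactness at `F_ω`
    Function.Surjective (LinearSymplectic.anchorOnto ω) := by
  refine ⟨fun p _ => LinearSymplectic.projective_sec _, LinearSymplectic.projective_sec _,
    fun p hp => ?_, fun p hp => ?_, LinearSymplectic.exact_delBar_connect ω hω,
    LinearSymplectic.exact_connect_anchorOnto ω hω, LinearMap.surjective_rangeRestrict _⟩
  · have := LinearSymplectic.subsingleton_coker ω hp
    refine ⟨fun f g => ?_⟩
    ext x
    exact Subsingleton.elim _ _
  · obtain ⟨q, rfl⟩ := Nat.exists_eq_add_of_le' hp
    exact LinearSymplectic.exact_delBar ω hω q
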